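/- Let $I=[a,b]\subset\mathbb{R}$ be a closed bounded interval with $a<b$. Let $\mathcal{K}(\mathbb{R})$ be the set of all non-empty compact subsets of $\mathbb{R}$, equipped with the Hausdorff metric $$H_d(A,B)=\max\Big\{\sup_{x\in A}\inf_{y\in B}|x-y|,\ \sup_{y\in B}\inf_{x\in A}|x-y|\Big\},$$ and let $\mathcal{C}(I,\mathcal{K}(\mathbb{R}))$ be the set of all continuous maps $F:I\to\mathcal{K}(\mathbb{R})$, equipped with the metric $d_{\mathcal{C}}(F,G)=\sup_{u\in I}H_d(F(u),G(u))$. For $F\in\mathcal{C}(I,\mathcal{K}(\mathbb{R}))$ let $$\mathcal{G}(F)=\{(u,F(u)):u\in I\}\subset I\times\mathcal{K}(\mathbb{R}),$$ where $I\times\mathcal{K}(\mathbb{R})$ carries the metric $D_{\mathcal{G}}((u,A),(w,B))=|u-w|+H_d(A,B)$, and let $\dim_H(\mathcal{G}(F))$ be the Hausdorff dimension of $\mathcal{G}(F)$ with respect to $D_{\mathcal{G}}$. Then for every real number $\beta\ge 1$ the set $$\mathcal{S}_\beta=\{F\in\mathcal{C}(I,\mathcal{K}(\mathbb{R})):\dim_H(\mathcal{G}(F))=\beta\}$$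 is dense in $\mathcal{C}(I,\mathcal{K}(\mathbb{R}))$. -/

import Mathlib

open TopologicalSpace

/-- The product `I × K(ℝ)` of the interval `I = [a, b]` with the space `K(ℝ)` of nonempty compact
subsets of `ℝ` (with its Hausdorff metric), carrying the sum metric
`D((u, A), (w, B)) = |u - w| + H_d(A, B)`. -/
abbrev GraphSpace (a b : ℝ) : Type :=
  WithLp 1 (Set.Icc a b × NonemptyCompacts ℝ)

/-- The graph `{(u, F(u)) : u ∈ I}` of a set-valued map `F : I → K(ℝ)`, as a subset of
`I × K(ℝ)` with the sum metric (the value `F(u)` is a single point of `K(ℝ)`). -/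
def newGraph {a b : ℝ} (F : Set.Icc a b → NonemptyCompacts ℝ) : Set (GraphSpace a b) :=
  {p | ∃ u : Set.Icc a b, p = WithLp.toLp 1 (u, F u)}

/-- The set of all continuous maps `F : I → K(ℝ)` whose graph in `I × K(ℝ)` has Hausdorff
dimension `β` (used for `β ≥ 0`). -/
def graphDimSet (a b β : ℝ) : Set C(Set.Icc a b, NonemptyCompacts ℝ) :=
  {F | dimH (newGraph F) = ENNReal.ofReal β}

open Metric Filter Topology

open scoped NNReal ENNReal

namespace TopologicalSpace.NonemptyCompacts

/-! Approximate `F` by a Lipschitz map `Ψ` and attach, above the maximum of each `Ψ u`, a small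
sequence of isolated points whose heights vibrate like `r ^ k * sin (2 ^ k * u)` with `r = 2 ^
(-1/β)`. The spikes are so well separated that the Hausdorff distance sees each vibration
individually, not their sum. Up to the Lipschitz error of `Ψ`, the decorated sets at `u` and `w`
therefore differ by about `sup_k r ^ k * |sin (2 ^ k * u) - sin (2 ^ k * w)|`, which is comparable
to `|u - w| ^ (1/β)` for `|u - w| ≤ 1`. The graph is thus a snowflake copy of `I`, of dimension `β`;
a small amplitude `η` keeps it close to `F`. The main lemmas are `exists_lipschitz_approx`,
`exists_le_pow_mul_abs_sin_sub_sin`, `abs_spike_sub_spike_le_dist_decorate` and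
`dimH_newGraph_of_holder`. -/

theorem exists_mem_abs_sub_le_dist {A : NonemptyCompacts ℝ} (B : NonemptyCompacts ℝ) {x : ℝ}
    (hx : x ∈ A) : ∃ y ∈ B, |x - y| ≤ dist A B := by
  obtain ⟨y, hy, h⟩ := B.isCompact.exists_infDist_eq_dist B.nonempty x
  refine ⟨y, hy, ?_⟩
  rw [← Real.dist_eq, ← h]
  exact infDist_le_hausdorffDist_of_mem hx (edist_ne_top A B)

theorem dist_le_of_forall_mem {A B : NonemptyCompacts ℝ} {r : ℝ} (hr : 0 ≤ r)
    (hA : ∀ x ∈ A, ∃ y ∈ B, |x - y| ≤ r) (hB : ∀ x ∈ B, ∃ y ∈ A, |x - y| ≤ r) :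
    dist A B ≤ r :=
  hausdorffDist_le_of_mem_dist hr hA hB

theorem sSup_le_sSup_add_dist (A B : NonemptyCompacts ℝ) :
    sSup (A : Set ℝ) ≤ sSup (B : Set ℝ) + dist A B := by
  obtain ⟨y, hy, h⟩ := exists_mem_abs_sub_le_dist B (A.isCompact.sSup_mem A.nonempty)
  have := le_csSup B.isCompact.bddAbove hy
  linarith [le_abs_self (sSup (A : Set ℝ) - y)]

theorem abs_sSup_sub_sSup_le_dist (A B : NonemptyCompacts ℝ) :
    |sSup (A : Set ℝ) - sSup (B : Set ℝ)| ≤ dist A B := by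
  have h := sSup_le_sSup_add_dist A B
  have h' := sSup_le_sSup_add_dist B A
  rw [dist_comm] at h'
  exact abs_sub_le_iff.2 ⟨by linarith, by linarith⟩

end TopologicalSpace.NonemptyCompacts

open NonemptyCompacts

/-! ### Lipschitz approximation of compact-valued maps. -/

theorem exists_nat_chain {A : ℕ → NonemptyCompacts ℝ} {e : ℝ}
    (hA : ∀ n, dist (A n) (A (n + 1)) ≤ e) {x : ℝ} (hx : x ∈ A 0) :
    ∃ c : ℕ → ℝ, c 0 = x ∧ (∀ n, c n ∈ A n) ∧ ∀ n, |c (n + 1) - c n| ≤ e := by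
  have step : ∀ n, ∀ y : A n, ∃ z : A (n + 1), |(z : ℝ) - y| ≤ e := by
    rintro n ⟨y, hy⟩
    obtain ⟨z, hz, h⟩ := exists_mem_abs_sub_le_dist (A (n + 1)) hy
    exact ⟨⟨z, hz⟩, by rw [abs_sub_comm]; exact h.trans (hA n)⟩
  choose f hf using step
  let c : ∀ n, A n := fun n => Nat.rec ⟨x, hx⟩ f n
  exact ⟨fun n => Subtype.val (c n), rfl, fun n => (c n).2, fun n => hf n (c n)⟩

theorem exists_int_chain {A : ℤ → NonemptyCompacts ℝ} {e : ℝ}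
    (hA : ∀ n, dist (A n) (A (n + 1)) ≤ e) {x : ℝ} (hx : x ∈ A 0) :
    ∃ c : ℤ → ℝ, c 0 = x ∧ (∀ n, c n ∈ A n) ∧ ∀ n, |c (n + 1) - c n| ≤ e := by
  obtain ⟨p, p0, hp, hp'⟩ := exists_nat_chain (A := fun n : ℕ => A n) (e := e)
    (fun n => by simpa using hA n) hx
  obtain ⟨q, q0, hq, hq'⟩ := exists_nat_chain (A := fun n : ℕ => A (-n)) (e := e)
    (fun n => by
      have := hA (-((n + 1 : ℕ) : ℤ))
      rw [dist_comm]
      convert this using 3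
      push_cast; ring) hx
  refine ⟨fun n => if 0 ≤ n then p n.toNat else q (-n).toNat, by simpa, fun n => ?_, fun n => ?_⟩
  · dsimp only
    split_ifs with h
    · simpa [h] using hp n.toNat
    · have := hq (-n).toNat
      rwa [Int.toNat_of_nonneg (by omega), neg_neg] at this
  · rcases lt_or_ge n 0 with h | h
    · obtain ⟨k, rfl⟩ : ∃ k : ℕ, n = -(k + 1) := ⟨(-n - 1).toNat, by omega⟩
      have hk : (if 0 ≤ -((k : ℤ) + 1) + 1 then p (-((k : ℤ) + 1) + 1).toNat
          else q (-(-((k : ℤ) + 1) + 1)).toNat) = q k := by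
        rcases Nat.eq_zero_or_pos k with rfl | hk
        · simp [p0, q0]
        · rw [if_neg (by omega)]
          congr 1
          omega
      dsimp only
      rw [hk, if_neg (by omega), show (- -((k : ℤ) + 1)).toNat = k + 1 by omega, abs_sub_comm]
      exact hq' k
    · obtain ⟨k, rfl⟩ := Int.eq_ofNat_of_zero_le h
      dsimp only
      rw [if_pos (by omega), if_pos (by omega), show ((k : ℤ) + 1).toNat = k + 1 by omega]
      exact hp' k

theorem abs_sub_le_mul_abs_of_abs_succ_sub_le {c : ℤ → ℝ} {e : ℝ}
    (hc : ∀ n, |c (n + 1) - c n| ≤ e) (m n : ℤ) : |c m - c n| ≤ e * |(m : ℝ) - n| := by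
  wlog h : n ≤ m generalizing m n
  · rw [abs_sub_comm, abs_sub_comm (m : ℝ)]
    exact this n m (by omega)
  obtain ⟨k, rfl⟩ := Int.le.dest h
  clear h
  induction k with
  | zero => simp
  | succ k ih =>
    have := abs_sub_le (c (n + k + 1)) (c (n + k)) (c n)
    have hk := hc (n + k)
    have e1 : |((n + k : ℤ) : ℝ) - n| = k := by simp
    have e2 : |((n + (k + 1 : ℕ) : ℤ) : ℝ) - n| = k + 1 := by
      push_cast
      rw [add_sub_cancel_left, abs_of_nonneg (by positivity)]
    rw [e1] at ih
    rw [e2]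
    push_cast
    rw [← add_assoc]
    linarith

/-- Every point of a value of a uniformly continuous compact-valued map lies on the graph of a
Lipschitz function that stays close to the map. -/
theorem exists_lipschitz_near_selection {Φ : ℝ → NonemptyCompacts ℝ} {δ e : ℝ≥0} (hδ : 0 < δ)
    (hΦ : ∀ u w : ℝ, |u - w| ≤ δ → dist (Φ u) (Φ w) ≤ e) {u₀ x : ℝ} (hx : x ∈ Φ u₀) :
    ∃ g : ℝ → ℝ, LipschitzWith (e / δ) g ∧ g u₀ = x ∧
      ∀ u, ∃ y ∈ Φ u, |g u - y| ≤ 2 * e := by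
  have hδ' : (0 : ℝ) < δ := hδ
  obtain ⟨c, c0, hc, hc'⟩ := exists_int_chain (A := fun n : ℤ => Φ (u₀ + n * δ)) (e := e)
    (fun n => hΦ _ _ (by push_cast; ring_nf; simp)) (x := x) (by simpa using hx)
  have hinj : Function.Injective fun n : ℤ => u₀ + n * (δ : ℝ) := by
    intro m n h
    have : (m : ℝ) * δ = n * δ := by simpa using h
    exact_mod_cast mul_right_cancel₀ hδ'.ne' this
  have hval : ∀ n : ℤ, Function.invFun (fun n : ℤ => u₀ + n * (δ : ℝ)) (u₀ + n * δ) = n :=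
    Function.leftInverse_invFun hinj
  obtain ⟨g, hg, hgeq⟩ := LipschitzOnWith.extend_real
    (f := fun u => c (Function.invFun (fun n : ℤ => u₀ + n * (δ : ℝ)) u))
    (s := Set.range fun n : ℤ => u₀ + n * (δ : ℝ)) (K := e / δ) (by
      refine LipschitzOnWith.of_dist_le_mul ?_
      rintro _ ⟨m, rfl⟩ _ ⟨n, rfl⟩
      dsimp only
      rw [hval, hval, Real.dist_eq, Real.dist_eq]
      refine (abs_sub_le_mul_abs_of_abs_succ_sub_le hc' m n).trans_eq ?_
      rw [show u₀ + m * (δ : ℝ) - (u₀ + n * δ) = (m - n) * δ by ring, abs_mul, abs_of_pos hδ']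
      push_cast
      field_simp)
  have hgn : ∀ n : ℤ, g (u₀ + n * δ) = c n := fun n => by
    rw [← hgeq ⟨n, rfl⟩]
    simp only [hval]
  refine ⟨g, hg, by simpa [c0] using hgn 0, fun u => ?_⟩
  -- Moving from `u` to the lattice node on its left costs `e` for `g` and `e` for `Φ`, hence `2 *
  -- e`.
  set n : ℤ := ⌊(u - u₀) / δ⌋
  have h1 : (n : ℝ) * δ ≤ u - u₀ := (le_div_iff₀ hδ').1 (Int.floor_le _)
  have h2 : u - u₀ < (n + 1) * δ := (div_lt_iff₀ hδ').1 (Int.lt_floor_add_one _)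
  have hd : |u - (u₀ + n * δ)| ≤ δ := abs_le.2 ⟨by linarith, by linarith⟩
  obtain ⟨y, hy, hy'⟩ := exists_mem_abs_sub_le_dist (Φ u) (hc n)
  refine ⟨y, hy, ?_⟩
  have h3 : |g u - c n| ≤ e := by
    have := hg.dist_le_mul u (u₀ + n * δ)
    rw [hgn, Real.dist_eq, Real.dist_eq] at this
    refine this.trans ((mul_le_mul_of_nonneg_left hd (by positivity)).trans_eq ?_)
    push_cast
    field_simp
  have h4 := hΦ _ _ hd
  rw [dist_comm] at h4
  linarith [abs_sub_le (g u) (c n) y]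

/-- Take all `L`-Lipschitz functions staying `ε`-close to `Φ`. The closure of their values at `u` is
`L`-Lipschitz in `u`, and it contains `Φ u` because near-selections pass through every point. -/
theorem exists_lipschitz_approx {Φ : ℝ → NonemptyCompacts ℝ} (hΦ : UniformContinuous Φ)
    {ε : ℝ} (hε : 0 < ε) :
    ∃ (L : ℝ≥0) (Ψ : ℝ → NonemptyCompacts ℝ), LipschitzWith L Ψ ∧ ∀ u, dist (Ψ u) (Φ u) ≤ ε := by
  lift ε to ℝ≥0 using hε.le
  obtain ⟨δ', hδ', hΦδ⟩ := Metric.uniformContinuous_iff.1 hΦ (ε / 2) (half_pos hε)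
  lift δ' to ℝ≥0 using hδ'.le
  obtain ⟨δ, hδ, hlt⟩ := exists_between (NNReal.coe_pos.1 hδ')
  -- Half of `ε`, since near-selections stray by twice the modulus.
  have hΦ' : ∀ u w : ℝ, |u - w| ≤ δ → dist (Φ u) (Φ w) ≤ (ε / 2 : ℝ≥0) := fun u w h => by
    push_cast
    exact (hΦδ (h.trans_lt (NNReal.coe_lt_coe.2 hlt))).le
  set L : ℝ≥0 := ε / 2 / δ
  let P : Set (ℝ → ℝ) := {g | LipschitzWith L g ∧ ∀ u, ∃ y ∈ Φ u, |g u - y| ≤ ε}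
  let E : ℝ → Set ℝ := fun u => (fun g : ℝ → ℝ => g u) '' P
  have hE : ∀ u, ∀ x ∈ E u, ∃ y ∈ Φ u, |x - y| ≤ ε := by
    rintro u _ ⟨g, hg, rfl⟩
    exact hg.2 u
  have hE' : ∀ u, (Φ u : Set ℝ) ⊆ E u := fun u x hx => by
    obtain ⟨g, hg, hgu, hgΦ⟩ := exists_lipschitz_near_selection hδ hΦ' hx
    refine ⟨g, ⟨hg, fun w => ?_⟩, hgu⟩
    obtain ⟨y, hy, h⟩ := hgΦ w
    exact ⟨y, hy, h.trans_eq (by push_cast; ring)⟩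
  have hbdd : ∀ u, Bornology.IsBounded (E u) := fun u =>
    (Φ u).isCompact.isBounded.cthickening (δ := ε) |>.subset fun x hx => by
      obtain ⟨y, hy, h⟩ := hE u x hx
      exact mem_cthickening_of_dist_le x y _ _ hy h
  refine ⟨L, fun u => ⟨⟨closure (E u), (hbdd u).isCompact_closure⟩,
    ((Φ u).nonempty.mono (hE' u)).closure⟩, LipschitzWith.of_dist_le_mul fun u w => ?_, fun u => ?_⟩
  · have key : ∀ u w : ℝ, ∀ x ∈ E u, ∃ y ∈ E w, dist x y ≤ L * dist u w := by
      rintro u w _ ⟨g, hg, rfl⟩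
      exact ⟨g w, ⟨g, hg, rfl⟩, hg.1.dist_le_mul u w⟩
    refine (hausdorffDist_closure (s := E u) (t := E w)).trans_le ?_
    exact hausdorffDist_le_of_mem_dist (by positivity) (key u w)
      (by rw [dist_comm]; exact key w u)
  · refine (hausdorffDist_closure₁ (s := E u) (t := (Φ u : Set ℝ))).trans_le ?_
    exact hausdorffDist_le_of_mem_dist hε.le (hE u)
      fun x hx => ⟨x, hE' u hx, by simp⟩

/-! ### Oscillation of lacunary sines. -/

theorem half_le_max_abs_cos (m : ℝ) : 1 / 2 ≤ |Real.cos m| ∨ 1 / 2 ≤ |Real.cos (2 * m)| := by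
  by_contra! h
  have h1 : Real.cos m ^ 2 < (1 / 2) ^ 2 := by
    rw [sq_lt_sq, abs_of_pos (a := (1 / 2 : ℝ)) (by norm_num)]
    exact h.1
  have h2 := neg_lt_of_abs_lt h.2
  rw [Real.cos_two_mul] at h2
  linarith

theorem half_mul_le_sin {x : ℝ} (h0 : 0 ≤ x) (h1 : x ≤ 1) : x / 2 ≤ Real.sin x := by
  refine le_trans ?_ (Real.mul_le_sin h0 (h1.trans (by linarith [Real.pi_gt_three])))
  have : (1 : ℝ) / 2 ≤ 2 / Real.pi := by
    rw [div_le_div_iff₀ (by norm_num) Real.pi_pos]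
    linarith [Real.pi_lt_four]
  nlinarith

/-- In `sin x - sin y = 2 sin ((x - y) / 2) cos ((x + y) / 2)` the cosine may vanish, but then it is
large at the doubled frequency. -/
theorem le_abs_sin_sub_sin {x y : ℝ} (h : 1 / 2 ≤ |x - y|) (h' : |x - y| ≤ 1) :
    1 / 8 ≤ |Real.sin x - Real.sin y| ∨ 1 / 8 ≤ |Real.sin (2 * x) - Real.sin (2 * y)| := by
  wlog hxy : y ≤ x generalizing x y
  · rw [abs_sub_comm (Real.sin x), abs_sub_comm (Real.sin (2 * x))]
    rw [abs_sub_comm] at h h'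
    exact this h h' (le_of_not_ge hxy)
  rw [abs_of_nonneg (sub_nonneg.2 hxy)] at h h'
  rw [Real.sin_sub_sin, Real.sin_sub_sin, abs_mul, abs_mul, abs_mul, abs_mul,
    show (2 * x - 2 * y) / 2 = x - y by ring, show (2 * x + 2 * y) / 2 = 2 * ((x + y) / 2) by ring,
    abs_two]
  have h1 : 1 / 8 ≤ |Real.sin ((x - y) / 2)| :=
    le_trans (by linarith) ((half_mul_le_sin (x := (x - y) / 2) (by linarith) (by linarith)).trans
      (le_abs_self _))
  have h2 : 1 / 8 ≤ |Real.sin (x - y)| :=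
    le_trans (by linarith) ((half_mul_le_sin (x := x - y) (by linarith) (by linarith)).trans
      (le_abs_self _))
  rcases half_le_max_abs_cos ((x + y) / 2) with hc | hc
  · left; nlinarith
  · right; nlinarith

theorem exists_two_pow_mul_mem {d : ℝ} (h0 : 0 < d) (h1 : d ≤ 1) :
    ∃ k : ℕ, 1 / 2 ≤ 2 ^ k * d ∧ 2 ^ k * d ≤ 1 := by
  obtain ⟨k, hk, hk'⟩ := exists_nat_pow_near (one_le_inv_iff₀.2 ⟨h0, h1⟩) (one_lt_two (α := ℝ))
  rw [inv_lt_iff_one_lt_mul₀ h0, pow_succ] at hk'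
  exact ⟨k, by linarith, (le_inv_mul_iff₀ h0).1 (by simpa using hk) |>.trans_eq' (mul_comm _ _)⟩

theorem rpow_neg_pow_eq (α : ℝ) (k : ℕ) : ((2 : ℝ) ^ (-α)) ^ k = ((2 : ℝ) ^ k) ^ (-α) := by
  rw [← Real.rpow_natCast, ← Real.rpow_natCast, ← Real.rpow_mul two_pos.le,
    ← Real.rpow_mul two_pos.le, mul_comm]

theorem min_two_le_two_mul_rpow {α x : ℝ} (h0 : 0 ≤ α) (h1 : α ≤ 1) (hx : 0 ≤ x) :
    min 2 x ≤ 2 * x ^ α := by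
  rcases le_total x 1 with h | h
  · have : x ≤ x ^ α := by simpa using Real.rpow_le_rpow_of_exponent_ge' hx h h0 h1
    linarith [min_le_right 2 x]
  · linarith [min_le_left 2 x, Real.one_le_rpow h h0]

/-- Interpolating between the trivial bound `2` and the Lipschitz bound `2 ^ k * |u - w|` produces a
factor `(2 ^ k) ^ α`, which the amplitude cancels; the bound is uniform in `k`. -/
theorem pow_mul_abs_sin_sub_sin_le {α : ℝ} (h0 : 0 ≤ α) (h1 : α ≤ 1) (k : ℕ) (u w : ℝ) :
    ((2 : ℝ) ^ (-α)) ^ k * |Real.sin (2 ^ k * u) - Real.sin (2 ^ k * w)| ≤ 2 * |u - w| ^ α := by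
  have hs : |Real.sin (2 ^ k * u) - Real.sin (2 ^ k * w)| ≤ min 2 (2 ^ k * |u - w|) := by
    refine le_min ?_ ((Real.abs_sin_sub_sin_le _ _).trans_eq ?_)
    · rw [abs_le]
      constructor <;> linarith [Real.sin_le_one (2 ^ k * u), Real.sin_le_one (2 ^ k * w),
        Real.neg_one_le_sin (2 ^ k * u), Real.neg_one_le_sin (2 ^ k * w)]
    · rw [← mul_sub, abs_mul, abs_of_pos (a := (2 : ℝ) ^ k) (by positivity)]
  rw [rpow_neg_pow_eq]
  calc ((2 : ℝ) ^ k) ^ (-α) * |Real.sin (2 ^ k * u) - Real.sin (2 ^ k * w)|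
      ≤ ((2 : ℝ) ^ k) ^ (-α) * (2 * (2 ^ k * |u - w|) ^ α) := by
        gcongr
        exact hs.trans (min_two_le_two_mul_rpow h0 h1 (by positivity))
    _ = 2 * |u - w| ^ α := by
        rw [Real.mul_rpow (by positivity) (abs_nonneg _), Real.rpow_neg (by positivity)]
        field_simp

/-- At the scale where `2 ^ k * |u - w|` lies in `[1/2, 1]`, frequency `k` or `k + 1` oscillates by
at least `1/8`. The other factor `1/2` in `1/16` pays for passing to `k + 1`. -/
theorem exists_le_pow_mul_abs_sin_sub_sin {α : ℝ} (h0 : 0 ≤ α) (h1 : α ≤ 1) {u w : ℝ}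
    (hne : u ≠ w) (hd : |u - w| ≤ 1) :
    ∃ k : ℕ, |u - w| ^ α / 16 ≤
      ((2 : ℝ) ^ (-α)) ^ k * |Real.sin (2 ^ k * u) - Real.sin (2 ^ k * w)| := by
  have hpos : 0 < |u - w| := abs_pos.2 (sub_ne_zero.2 hne)
  obtain ⟨k, hk, hk'⟩ := exists_two_pow_mul_mem hpos hd
  have hr : (1 : ℝ) / 2 ≤ 2 ^ (-α) := by
    rw [one_div, ← Real.rpow_neg_one]
    exact Real.rpow_le_rpow_of_exponent_le one_le_two (by linarith)
  have hrk : |u - w| ^ α ≤ ((2 : ℝ) ^ (-α)) ^ k := by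
    rw [rpow_neg_pow_eq, Real.rpow_neg (by positivity), ← Real.inv_rpow (by positivity)]
    refine Real.rpow_le_rpow hpos.le ?_ h0
    rw [← one_div, le_div_iff₀' (by positivity)]
    exact hk'
  have habs : |2 ^ k * u - 2 ^ k * w| = 2 ^ k * |u - w| := by
    rw [← mul_sub, abs_mul, abs_of_pos (a := (2 : ℝ) ^ k) (by positivity)]
  have hpα : 0 ≤ |u - w| ^ α := by positivity
  rcases le_abs_sin_sub_sin (habs ▸ hk) (habs ▸ hk') with h | h
  · refine ⟨k, le_trans ?_ (mul_le_mul hrk h (by norm_num) (hpα.trans hrk))⟩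
    linarith
  · refine ⟨k + 1, ?_⟩
    rw [← mul_assoc, ← mul_assoc, ← pow_succ'] at h
    rw [pow_succ ((2 : ℝ) ^ (-α))]
    refine le_trans (le_of_eq ?_) (mul_le_mul (mul_le_mul hrk hr (by norm_num) (hpα.trans hrk)) h
      (by norm_num) (by positivity))
    ring

/-! ### Separation of the spikes. -/

/-- The height over the base point of the `k`-th isolated point of the decoration at time `u`. -/
noncomputable def spike (r η : ℝ) (k : ℕ) (u : ℝ) : ℝ :=
  η * (r ^ k * (4 / (1 - r) + Real.sin (2 ^ k * u)))

section spike

variable {r η : ℝ}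

theorem four_le_four_div (h0 : 0 ≤ r) (h1 : r < 1) : 4 ≤ 4 / (1 - r) := by
  rw [le_div_iff₀ (by linarith)]
  linarith

theorem two_mul_le_spike (h0 : 0 ≤ r) (h1 : r < 1) (hη : 0 ≤ η) (k : ℕ) (u : ℝ) :
    η * (2 * r ^ k) ≤ spike r η k u := by
  have := four_le_four_div h0 h1
  have := Real.neg_one_le_sin (2 ^ k * u)
  unfold spike
  rw [mul_comm 2]
  gcongr
  linarith

theorem spike_le (h0 : 0 ≤ r) (hη : 0 ≤ η) (k : ℕ) (u : ℝ) :
    spike r η k u ≤ η * (r ^ k * (4 / (1 - r) + 1)) := by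
  unfold spike
  gcongr
  exact Real.sin_le_one _

theorem spike_le_of_pow_le_one (h0 : 0 ≤ r) (h1 : r < 1) (hη : 0 ≤ η) (k : ℕ) (u : ℝ) :
    spike r η k u ≤ η * (4 / (1 - r) + 1) := by
  refine (spike_le h0 hη k u).trans ?_
  have := four_le_four_div h0 h1
  gcongr
  exact mul_le_of_le_one_left (by linarith) (pow_le_one₀ h0 h1.le)

theorem spike_nonneg (h0 : 0 ≤ r) (h1 : r < 1) (hη : 0 ≤ η) (k : ℕ) (u : ℝ) :
    0 ≤ spike r η k u :=
  le_trans (by positivity) (two_mul_le_spike h0 h1 hη k u)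

/-- The offset `4 / (1 - r)` is chosen for this: mean heights differ by at least `4 * η * r ^ j`,
and the two sines take back at most `2 * η * r ^ j`. -/
theorem two_mul_le_spike_sub_spike (h0 : 0 ≤ r) (h1 : r < 1) (hη : 0 ≤ η) {j k : ℕ} (hjk : j < k)
    (u w : ℝ) : η * (2 * r ^ j) ≤ spike r η j u - spike r η k w := by
  unfold spike
  rw [← mul_sub]
  refine mul_le_mul_of_nonneg_left ?_ hη
  have hC := four_le_four_div h0 h1
  have hr : r ^ k ≤ r ^ j * r := by
    rw [← pow_succ]
    exact pow_le_pow_of_le_one h0 h1.le hjk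
  have hrj : 0 ≤ r ^ j := by positivity
  have e : r ^ j * (4 / (1 - r)) - r ^ j * r * (4 / (1 - r)) = 4 * r ^ j := by
    have : 1 - r ≠ 0 := by linarith
    field_simp
  have h2 : r ^ k * (4 / (1 - r) + Real.sin (2 ^ k * w)) ≤ r ^ j * r * (4 / (1 - r) + 1) := by
    gcongr
    · linarith [Real.neg_one_le_sin (2 ^ k * w)]
    · exact Real.sin_le_one _
  have h3 : r ^ j * (4 / (1 - r) - 1) ≤ r ^ j * (4 / (1 - r) + Real.sin (2 ^ j * u)) := by
    gcongr
    linarith [Real.neg_one_le_sin (2 ^ j * u)]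
  nlinarith

theorem abs_spike_sub_spike_self (hr : 0 ≤ r) (hη : 0 ≤ η) (k : ℕ) (u w : ℝ) :
    |spike r η k u - spike r η k w| =
      η * (r ^ k * |Real.sin (2 ^ k * u) - Real.sin (2 ^ k * w)|) := by
  unfold spike
  rw [← mul_sub, ← mul_sub, add_sub_add_left_eq_sub, abs_mul, abs_mul, abs_of_nonneg hη,
    abs_of_nonneg (pow_nonneg hr k)]

/-- The vibration of the `k`-th spike is at most the distance to any spike at another time. -/
theorem abs_spike_sub_spike_le (h0 : 0 ≤ r) (h1 : r < 1) (hη : 0 ≤ η) (j k : ℕ) (u w : ℝ) :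
    |spike r η k u - spike r η k w| ≤ |spike r η k u - spike r η j w| := by
  rcases eq_or_ne j k with rfl | hne
  · rfl
  have hle : |Real.sin (2 ^ k * u) - Real.sin (2 ^ k * w)| ≤ 2 := by
    rw [abs_le]
    constructor <;> linarith [Real.sin_le_one (2 ^ k * u), Real.sin_le_one (2 ^ k * w),
      Real.neg_one_le_sin (2 ^ k * u), Real.neg_one_le_sin (2 ^ k * w)]
  have hk : |spike r η k u - spike r η k w| ≤ η * (2 * r ^ k) := by
    rw [abs_spike_sub_spike_self h0 hη, mul_comm 2]
    gcongr
  refine hk.trans ?_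
  rcases lt_or_gt_of_ne hne with h | h
  · rw [abs_sub_comm]
    refine le_trans ?_ ((two_mul_le_spike_sub_spike h0 h1 hη h w u).trans (le_abs_self _))
    gcongr η * (2 * ?_)
    exact pow_le_pow_of_le_one h0 h1.le h.le
  · exact (two_mul_le_spike_sub_spike h0 h1 hη h u w).trans (le_abs_self _)

theorem abs_spike_sub_spike_le_spike (h0 : 0 ≤ r) (h1 : r < 1) (hη : 0 ≤ η) (k : ℕ) (u w : ℝ) :
    |spike r η k u - spike r η k w| ≤ spike r η k u := by
  refine le_trans ?_ (two_mul_le_spike h0 h1 hη k u)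
  rw [abs_spike_sub_spike_self h0 hη, mul_comm 2]
  gcongr
  rw [abs_le]
  constructor <;> linarith [Real.sin_le_one (2 ^ k * u), Real.sin_le_one (2 ^ k * w),
    Real.neg_one_le_sin (2 ^ k * u), Real.neg_one_le_sin (2 ^ k * w)]

theorem tendsto_spike (h0 : 0 ≤ r) (h1 : r < 1) (hη : 0 ≤ η) (u : ℝ) :
    Tendsto (fun k => spike r η k u) atTop (𝓝 0) := by
  refine squeeze_zero (fun k => spike_nonneg h0 h1 hη k u) (fun k => spike_le h0 hη k u) ?_
  simpa using ((tendsto_pow_atTop_nhds_zero_of_lt_one h0 h1).mul_const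
    (4 / (1 - r) + 1)).const_mul η

end spike

/-! ### Decorated sets and their Hausdorff distances. -/

/-- The compact set obtained from `A` by attaching the spikes at time `u` above its maximum. -/
noncomputable def decorate {r η : ℝ} (h0 : 0 ≤ r) (h1 : r < 1) (hη : 0 ≤ η)
    (A : NonemptyCompacts ℝ) (u : ℝ) : NonemptyCompacts ℝ where
  -- The maximum already lies in `A`; it is inserted as the limit of the spikes, which makes the
  -- second piece compact.
  carrier := (A : Set ℝ) ∪ insert (sSup (A : Set ℝ))
    (Set.range fun k => sSup (A : Set ℝ) + spike r η k u)
  isCompact' := A.isCompact.union <| Tendsto.isCompact_insert_range <| by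
    simpa using (tendsto_spike h0 h1 hη u).const_add (sSup (A : Set ℝ))
  nonempty' := A.nonempty.inl

section decorate

variable {r η : ℝ} (h0 : 0 ≤ r) (h1 : r < 1) (hη : 0 ≤ η)

theorem mem_decorate {A : NonemptyCompacts ℝ} {u x : ℝ} :
    x ∈ decorate h0 h1 hη A u ↔ x ∈ A ∨ ∃ k, sSup (A : Set ℝ) + spike r η k u = x := by
  change x ∈ (A : Set ℝ) ∪ insert (sSup (A : Set ℝ))
    (Set.range fun k => sSup (A : Set ℝ) + spike r η k u) ↔ _
  simp only [Set.mem_union, Set.mem_insert_iff, Set.mem_range, SetLike.mem_coe]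
  constructor
  · rintro (h | rfl | h)
    · exact Or.inl h
    · exact Or.inl (A.isCompact.sSup_mem A.nonempty)
    · exact Or.inr h
  · rintro (h | h)
    · exact Or.inl h
    · exact Or.inr (Or.inr h)

theorem dist_decorate_self_le (A : NonemptyCompacts ℝ) (u : ℝ) :
    dist (decorate h0 h1 hη A u) A ≤ η * (4 / (1 - r) + 1) := by
  have hC := four_le_four_div h0 h1
  have hnn : 0 ≤ η * (4 / (1 - r) + 1) := mul_nonneg hη (by linarith)
  refine dist_le_of_forall_mem hnn (fun x hx => ?_)
    fun x hx => ⟨x, (mem_decorate h0 h1 hη).2 (Or.inl hx), by simpa using hnn⟩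
  rcases (mem_decorate h0 h1 hη).1 hx with hx | ⟨k, rfl⟩
  · exact ⟨x, hx, by simpa using hnn⟩
  · refine ⟨_, A.isCompact.sSup_mem A.nonempty, ?_⟩
    rw [add_sub_cancel_left, abs_of_nonneg (spike_nonneg h0 h1 hη k u)]
    exact spike_le_of_pow_le_one h0 h1 hη k u

theorem dist_decorate_le {A B : NonemptyCompacts ℝ} {u w s : ℝ}
    (hs : ∀ k, |spike r η k u - spike r η k w| ≤ s) :
    dist (decorate h0 h1 hη A u) (decorate h0 h1 hη B w) ≤ dist A B + s := by
  have hs0 : 0 ≤ s := (abs_nonneg _).trans (hs 0)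
  have key : ∀ {A B : NonemptyCompacts ℝ} {u w : ℝ},
      (∀ k, |spike r η k u - spike r η k w| ≤ s) → ∀ x ∈ decorate h0 h1 hη A u,
      ∃ y ∈ decorate h0 h1 hη B w, |x - y| ≤ dist A B + s := by
    intro A B u w hs x hx
    rcases (mem_decorate h0 h1 hη).1 hx with hx | ⟨k, rfl⟩
    · obtain ⟨y, hy, h⟩ := exists_mem_abs_sub_le_dist B hx
      exact ⟨y, (mem_decorate h0 h1 hη).2 (Or.inl hy), by linarith⟩
    · refine ⟨_, (mem_decorate h0 h1 hη).2 (Or.inr ⟨k, rfl⟩), ?_⟩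
      rw [add_sub_add_comm]
      exact (abs_add_le _ _).trans (add_le_add (abs_sSup_sub_sSup_le_dist A B) (hs k))
  refine dist_le_of_forall_mem (by positivity) (key hs) ?_
  rw [dist_comm]
  exact key fun k => by rw [abs_sub_comm]; exact hs k

/-- Match the tip of spike `k` with a nearby point of the other set. Measured from the respective
maxima (a shift costing `dist A B`), that point is either at height at most `0` or another spike;
both are at least as far away as the vibration. -/
theorem abs_spike_sub_spike_le_dist_decorate (A B : NonemptyCompacts ℝ) (u w : ℝ) (k : ℕ) :
    |spike r η k u - spike r η k w| ≤
      dist (decorate h0 h1 hη A u) (decorate h0 h1 hη B w) + dist A B := by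
  obtain ⟨y, hy, h⟩ := exists_mem_abs_sub_le_dist (decorate h0 h1 hη B w)
    ((mem_decorate h0 h1 hη).2 (Or.inr ⟨k, rfl⟩) :
      sSup (A : Set ℝ) + spike r η k u ∈ decorate h0 h1 hη A u)
  have hm := abs_sSup_sub_sSup_le_dist A B
  suffices |spike r η k u - spike r η k w| ≤ |spike r η k u - (y - sSup (B : Set ℝ))| by
    have h2 := abs_sub (sSup (A : Set ℝ) + spike r η k u - y) (sSup (A : Set ℝ) - sSup (B : Set ℝ))
    rw [show sSup (A : Set ℝ) + spike r η k u - y - (sSup (A : Set ℝ) - sSup (B : Set ℝ)) =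
      spike r η k u - (y - sSup (B : Set ℝ)) by ring] at h2
    linarith
  rcases (mem_decorate h0 h1 hη).1 hy with hy | ⟨j, rfl⟩
  · refine (abs_spike_sub_spike_le_spike h0 h1 hη k u w).trans (le_trans ?_ (le_abs_self _))
    linarith [le_csSup B.isCompact.bddAbove hy]
  · rw [add_sub_cancel_left]
    exact abs_spike_sub_spike_le h0 h1 hη j k u w

end decorate

/-! ### Dimension of the decorated graph. -/

theorem holderOnWith_of_dist_le {X Y : Type*} [PseudoMetricSpace X] [PseudoMetricSpace Y]
    {K s : ℝ≥0} {f : X → Y} {t : Set X}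
    (h : ∀ x ∈ t, ∀ y ∈ t, dist (f x) (f y) ≤ K * dist x y ^ (s : ℝ)) : HolderOnWith K s f t := by
  intro x hx y hy
  have := h x hx y hy
  rw [← coe_nndist, ← coe_nndist] at this
  rw [edist_nndist, edist_nndist, ← ENNReal.coe_rpow_of_nonneg _ s.coe_nonneg]
  exact_mod_cast this

theorem dimH_univ_Icc {a b : ℝ} (hab : a < b) : dimH (Set.univ : Set (Set.Icc a b)) = 1 := by
  rw [← isometry_subtype_coe.dimH_image, Set.image_univ, Subtype.range_coe,
    Real.dimH_of_nonempty_interior (by simpa using hab)]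
  simp

/-- The graph is the image of `I` under a Hölder map of exponent `1/β`, so its dimension is at most
`β`. Its projection onto `I` is Hölder of exponent `β`, which gives the reverse bound. -/
theorem dimH_newGraph_of_holder {a b : ℝ} (hab : a < b) {G : Set.Icc a b → NonemptyCompacts ℝ}
    {β K K' : ℝ≥0} (hβ : 0 < β)
    (hup : ∀ u w, dist (WithLp.toLp 1 (u, G u)) (WithLp.toLp 1 (w, G w)) ≤
      K * dist u w ^ (β⁻¹ : ℝ))
    (hlow : ∀ u w, dist u w ^ (β⁻¹ : ℝ) ≤
      K' * dist (WithLp.toLp 1 (u, G u)) (WithLp.toLp 1 (w, G w))) :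
    dimH (newGraph G) = β := by
  have hgraph : newGraph G = Set.range fun u => (WithLp.toLp 1 (u, G u) : GraphSpace a b) := by
    ext p
    exact exists_congr fun u => eq_comm
  have hβ' : (β : ℝ) ≠ 0 := by exact_mod_cast hβ.ne'
  have hβ₀ : (β : ℝ≥0∞) ≠ 0 := by exact_mod_cast hβ.ne'
  apply le_antisymm
  · have h : HolderOnWith K β⁻¹ (fun u => (WithLp.toLp 1 (u, G u) : GraphSpace a b)) Set.univ :=
      holderOnWith_of_dist_le fun u _ w _ => by simpa using hup u w
    rw [hgraph, ← Set.image_univ]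
    refine (h.dimH_image_le (inv_pos.2 hβ)).trans_eq ?_
    rw [dimH_univ_Icc hab, ENNReal.coe_inv hβ.ne', one_div, inv_inv]
  · have h : HolderOnWith (K' ^ (β : ℝ)) β (fun p : GraphSpace a b => p.fst) (newGraph G) := by
      refine holderOnWith_of_dist_le ?_
      rintro _ ⟨u, rfl⟩ _ ⟨w, rfl⟩
      push_cast
      rw [← Real.mul_rpow K'.coe_nonneg dist_nonneg]
      refine le_trans (le_of_eq ?_) (Real.rpow_le_rpow (by positivity) (hlow u w) β.coe_nonneg)
      rw [← Real.rpow_mul dist_nonneg, inv_mul_cancel₀ hβ', Real.rpow_one]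
      rfl
    have himage : (fun p : GraphSpace a b => p.fst) '' newGraph G = Set.univ := by
      rw [hgraph, ← Set.range_comp]
      exact Set.range_eq_univ.2 fun u => ⟨u, rfl⟩
    have := h.dimH_image_le hβ
    rwa [himage, dimH_univ_Icc hab, ENNReal.le_div_iff_mul_le (Or.inl hβ₀)
      (Or.inl ENNReal.coe_ne_top), one_mul] at this

theorem dist_toLp_one {X Y : Type*} [PseudoMetricSpace X] [PseudoMetricSpace Y] (x x' : X)
    (y y' : Y) : dist (WithLp.toLp 1 (x, y)) (WithLp.toLp 1 (x', y')) = dist x x' + dist y y' := by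
  rw [WithLp.prod_dist_eq_add (by simp)]
  simp

/-- Decorating a Lipschitz map yields a graph that is bi-Hölder equivalent to the interval. -/
theorem dimH_newGraph_decorate {a b : ℝ} (hab : a < b) {Ψ : ℝ → NonemptyCompacts ℝ} {L : ℝ≥0}
    (hΨ : LipschitzWith L Ψ) {β : ℝ} (hβ : 1 ≤ β) {η : ℝ} (hη : 0 < η)
    (h0 : 0 ≤ (2 : ℝ) ^ (-β⁻¹)) (h1 : (2 : ℝ) ^ (-β⁻¹) < 1) :
    (Continuous fun u : Set.Icc a b => decorate h0 h1 hη.le (Ψ u) u) ∧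
    dimH (newGraph fun u : Set.Icc a b => decorate h0 h1 hη.le (Ψ u) u) = ENNReal.ofReal β := by
  have hβ0 : 0 < β := one_pos.trans_le hβ
  lift β to ℝ≥0 using hβ0.le
  lift η to ℝ≥0 using hη.le
  have hα0 : 0 ≤ (β⁻¹ : ℝ) := by positivity
  have hα1 : (β⁻¹ : ℝ) ≤ 1 := inv_le_one_of_one_le₀ hβ
  set G : Set.Icc a b → NonemptyCompacts ℝ := fun u => decorate h0 h1 hη.le (Ψ u) u
  have hΨd : ∀ u w : Set.Icc a b, dist (Ψ u) (Ψ w) ≤ L * dist u w := fun u w => hΨ.dist_le_mul _ _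
  let ℓ : ℝ≥0 := ⟨b - a, by linarith⟩
  -- The first term absorbs the Lipschitz part, as `|u - w| ≤ ℓ ^ (1 - 1/β) * |u - w| ^ (1/β)` on an
  -- interval of length `ℓ`; the second bounds the spikes.
  let K : ℝ≥0 := (1 + L) * ℓ ^ (1 - (β : ℝ)⁻¹) + 2 * η
  have hup : ∀ u w, dist (WithLp.toLp 1 (u, G u)) (WithLp.toLp 1 (w, G w)) ≤
      K * dist u w ^ (β⁻¹ : ℝ) := by
    intro u w
    rw [dist_toLp_one]
    have hd : dist u w ≤ ℓ ^ (1 - (β : ℝ)⁻¹) * dist u w ^ (β⁻¹ : ℝ) := by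
      have hle : dist u w ≤ ℓ := Real.dist_le_of_mem_Icc u.2 w.2
      rcases (dist_nonneg (x := u) (y := w)).eq_or_lt with h | h
      · rw [← h]; positivity
      · calc dist u w = dist u w ^ (1 - (β : ℝ)⁻¹) * dist u w ^ (β⁻¹ : ℝ) := by
              rw [← Real.rpow_add h, sub_add_cancel, Real.rpow_one]
          _ ≤ _ := by gcongr
    have hG : dist (G u) (G w) ≤ dist (Ψ u) (Ψ w) + η * (2 * dist u w ^ (β⁻¹ : ℝ)) := by
      refine dist_decorate_le h0 h1 hη.le fun k => ?_
      rw [abs_spike_sub_spike_self h0 hη.le]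
      refine mul_le_mul_of_nonneg_left ?_ η.coe_nonneg
      exact pow_mul_abs_sin_sub_sin_le hα0 hα1 k u w
    have := mul_le_mul_of_nonneg_left hd (add_nonneg zero_le_one L.coe_nonneg)
    simp only [K]
    push_cast
    linarith [hΨd u w]
  -- The summand `1` serves distances at least `1`, where `|u - w| ^ (1/β) ≤ |u - w|`; the other
  -- serves distances at most `1`, through the spikes.
  let K' : ℝ≥0 := 1 + 16 * (1 + L) / η
  have hlow : ∀ u w, dist u w ^ (β⁻¹ : ℝ) ≤
      K' * dist (WithLp.toLp 1 (u, G u)) (WithLp.toLp 1 (w, G w)) := by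
    intro u w
    rw [dist_toLp_one]
    have hη' : (0 : ℝ) < η := hη
    have hnn : 0 ≤ dist u w + dist (G u) (G w) := by positivity
    have hK' : (K' : ℝ) = 1 + 16 * (1 + L) / η := by simp [K']
    rw [hK', add_mul, one_mul]
    rcases eq_or_ne u w with rfl | hne
    · rw [dist_self, Real.zero_rpow (by positivity)]
      positivity
    rcases le_total (dist u w) 1 with hd | hd
    · obtain ⟨k, hk⟩ := exists_le_pow_mul_abs_sin_sub_sin hα0 hα1
        (fun h => hne (Subtype.ext h) : (u : ℝ) ≠ w) hd
      have hs := abs_spike_sub_spike_le_dist_decorate h0 h1 hη.le (Ψ u) (Ψ w) u w k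
      rw [abs_spike_sub_spike_self h0 hη.le] at hs
      have hk' := (mul_le_mul_of_nonneg_left hk hη'.le).trans hs
      have hmain : η * (dist u w ^ (β⁻¹ : ℝ) / 16) ≤ (1 + L) * (dist u w + dist (G u) (G w)) := by
        refine hk'.trans ?_
        have : 0 ≤ (L : ℝ) * dist (G u) (G w) := by positivity
        have : 0 ≤ dist u w := dist_nonneg
        linarith [hΨd u w]
      have : dist u w ^ (β⁻¹ : ℝ) ≤ 16 * (1 + L) / η * (dist u w + dist (G u) (G w)) := by
        rw [div_mul_eq_mul_div, le_div_iff₀ hη']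
        linarith
      linarith
    · have : dist u w ^ (β⁻¹ : ℝ) ≤ dist u w := by
        simpa using Real.rpow_le_rpow_of_exponent_le hd hα1
      have : 0 ≤ 16 * (1 + L) / η * (dist u w + dist (G u) (G w)) := by positivity
      linarith [dist_nonneg (x := G u) (y := G w)]
  refine ⟨?_, by simpa using dimH_newGraph_of_holder hab (NNReal.coe_pos.1 hβ0) hup hlow⟩
  have h : HolderOnWith K β⁻¹ G Set.univ := holderOnWith_of_dist_le fun u _ w _ => by
    have := hup u w
    rw [dist_toLp_one] at this
    push_cast
    linarith [dist_nonneg (x := u) (y := w)]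
  exact (holderOnWith_univ.1 h).continuous (inv_pos.2 (NNReal.coe_pos.1 hβ0))

/-! ### Density. -/

theorem theorem5p17 (a b : ℝ) (hab : a < b) (β : ℝ) (hβ : 1 ≤ β) :
    Dense (graphDimSet a b β) := by
  intro F
  refine (Metric.mem_closure_iff (α := C(Set.Icc a b, NonemptyCompacts ℝ))).2 fun ε hε => ?_
  have hβ0 : 0 < β := one_pos.trans_le hβ
  have h0 : 0 ≤ (2 : ℝ) ^ (-β⁻¹) := by positivity
  have h1 : (2 : ℝ) ^ (-β⁻¹) < 1 :=
    Real.rpow_lt_one_of_one_lt_of_neg one_lt_two (neg_lt_zero.2 (inv_pos.2 hβ0))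
  -- `F` is extended to `ℝ` by its endpoint values, so that lattices of nodes never leave the
  -- domain.
  have hΦ : UniformContinuous fun u : ℝ => F (Set.projIcc a b hab.le u) :=
    (CompactSpace.uniformContinuous_of_continuous F.continuous).comp
      (LipschitzWith.projIcc hab.le).uniformContinuous
  obtain ⟨L, Ψ, hΨ, hΨF⟩ := exists_lipschitz_approx hΦ (ε := ε / 3) (by positivity)
  have hC : 0 < 4 / (1 - (2 : ℝ) ^ (-β⁻¹)) + 1 := by linarith [four_le_four_div h0 h1]
  -- This amplitude makes the bound on the highest spike exactly `ε / 3`.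
  have hη : 0 < ε / 3 / (4 / (1 - (2 : ℝ) ^ (-β⁻¹)) + 1) := by positivity
  obtain ⟨hcont, hdim⟩ := dimH_newGraph_decorate hab hΨ hβ hη h0 h1
  refine ⟨⟨_, hcont⟩, hdim, ?_⟩
  rw [dist_comm]
  refine lt_of_le_of_lt ((ContinuousMap.dist_le (C := ε / 3 + ε / 3) (by positivity)).2
    fun u => ?_) (by linarith)
  refine (dist_triangle (α := NonemptyCompacts ℝ) _ (Ψ u) _).trans (add_le_add ?_ ?_)
  · refine (dist_decorate_self_le h0 h1 hη.le _ _).trans_eq ?_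
    exact div_mul_cancel₀ _ hC.ne'
  · simpa using hΨF u
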